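/- **Model.** A base station with one transmit antenna and $M$ receive antennas transmits frames of length $L\ge 1$ with power budget $p>0$ per time slot; it serves a near user (N) and a far user (F) and senses $K$ radar targets. Channels: $h_1\sim\mathcal{CN}(0,\varrho_1)$ and $h_2\sim\mathcal{CN}(0,\varrho_2)$ are independent, $\varrho_1,\varrho_2>0$, and $|h_{\rm N}|=\max\{|h_1|,|h_2|\}$, $|h_{\rm F}|=\min\{|h_1|,|h_2|\}$. Power allocation: $\alpha_{\rm N}+\alpha_{\rm F}=1$, $0\le\alpha_{\rm N}<\alpha_{\rm F}$. Noise variances for communications and sensing: $\sigma_{\rm c}^2,\sigma_{\rm s}^2>0$. Target response: $\mathbf g=\sum_{k=1}^K\beta_k\mathbf a(\theta_k)\in\mathbb C^M$ with arbitrary angles $\theta_k$, an arbitrary array response $\mathbf a:\mathbb R\to\mathbb C^M$, and $\beta_k\sim\mathcal{CN}(0,\sigma_k^2)$, $\sigma_k^2\ge 0$. The sensing noise $\mathbf N_{\rm s}\in\mathbb C^{M\times L}$ has entries $\mathcal{CN}(0,\sigma_{\rm s}^2)$; all the $\beta_k$ and all entries of $\mathbf N_{\rm s}$ are mutually independent.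 $\mathbf S\in\mathbb C^{2\times L}$ is the random matrix of the users' data streams, with $\mathbf S\mathbf S^{\mathsf H}=L\mathbf I_2$ almost surely, and $\mathbf s\in\mathbb C^L$ is a random radar-only waveform with $\mathbf s^{\mathsf H}\mathbf s=L$ almost surely; each of $\mathbf S$, $\mathbf s$ is independent of $(\beta_1,\dots,\beta_K,\mathbf N_{\rm s})$. **Communication rate.** For a bandwidth fraction $\kappa\in[0,1]$ and a power fraction $\mu\in[0,1]$ put $$\gamma^{\rm N}=\frac{\mu p|h_{\rm N}|^2\alpha_{\rm N}}{\kappa\sigma_{\rm c}^2},\qquad \gamma^{\rm F}=\frac{\mu p|h_{\rm F}|^2\alpha_{\rm F}}{\kappa\sigma_{\rm c}^2+\mu p|h_{\rm F}|^2\alpha_{\rm N}},\qquad \mathcal R^{\rm c}(\kappa,\mu)=\mathbb E\{\kappa\log_2(1+\gamma^{\rm N})\}+\mathbb E\{\kappa\log_2(1+\gamma^{\rm F})\},$$ with $\mathcal R^{\rm c}(0,\mu)=0$. **Sensing rate.** In a bandwidth fraction $b\in(0,1]$ with transmitted waveform $\mathbf x\in\mathbb C^L$ the echo is $\mathbf Y=\mathbf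 g\mathbf x^{\mathsf T}+\sqrt b\,\mathbf N_{\rm s}$ (noise variance $b\sigma_{\rm s}^2$ per entry), and the sensing rate is $\mathcal R^{\rm s}(b,\mathbf x)=\frac bL I(\mathbf Y;\mathbf g\mid\mathbf x)$, with $I$ the conditional mutual information in bits; $\mathcal R^{\rm s}(0,\mathbf x)=0$. **Rate regions.** NOMA-ISAC (integrated sensing and communications) uses the whole bandwidth and power for both tasks, with waveform $\mathbf x_{\rm i}^{\mathsf T}=\sqrt p\,[\sqrt{\alpha_{\rm N}},\sqrt{\alpha_{\rm F}}]\,\mathbf S$; NOMA-FDSAC (frequency-division sensing and communications) gives the fractions $\kappa$ of the bandwidth and $\mu$ of the power to communications and the rest to sensing, with waveform $\mathbf x_{\rm f}=\sqrt{(1-\mu)p}\,\mathbf s$. Their regions of achievable pairs (sensing rate, sum ergodic communication rate) are $$\mathcal C_{\rm isac}=\{(R^{\rm s},R^{\rm c}) : 0\le R^{\rm s}\le\mathcal R^{\rm s}(1,\mathbf x_{\rm i}),\ 0\le R^{\rm c}\le\mathcal R^{\rm c}(1,1)\},$$ $$\mathcal C_{\rm fdsac}=\bigcup_{\kappa\in[0,1]}\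 \bigcup_{\mu\in[0,1]}\{(R^{\rm s},R^{\rm c}) : 0\le R^{\rm s}\le\mathcal R^{\rm s}(1-\kappa,\mathbf x_{\rm f}),\ 0\le R^{\rm c}\le\mathcal R^{\rm c}(\kappa,\mu)\}.$$ **Theorem.** $\mathcal C_{\rm fdsac}\subseteq\mathcal C_{\rm isac}$. -/

import Mathlib

open MeasureTheory ProbabilityTheory Set
open scoped ENNReal NNReal Matrix

noncomputable section

namespace NomaIsac

/-- The circularly symmetric complex Gaussian law `CN(0, v)`: independent real and imaginary
parts, each `N(0, v / 2)`. -/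
def complexGaussian (v : ℝ≥0) : Measure ℂ :=
  ((gaussianReal 0 (v / 2)).prod (gaussianReal 0 (v / 2))).map
    (fun q : ℝ × ℝ => (⟨q.1, q.2⟩ : ℂ))

/-- The conditional mutual information `I(X; Y | Z)` in bits: the average over `Z` of the
Kullback-Leibler divergence of the conditional joint law of `(X, Y)` given `Z` from the product
of the conditional laws of `X` and of `Y` given `Z`. (`klDiv` is in nats.) -/
def condMutualInfo {Ω 𝒳 𝒴 𝒵 : Type*} [MeasurableSpace Ω]
    [MeasurableSpace 𝒳] [StandardBorelSpace 𝒳] [Nonempty 𝒳]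
    [MeasurableSpace 𝒴] [StandardBorelSpace 𝒴] [Nonempty 𝒴] [MeasurableSpace 𝒵]
    (P : Measure Ω) [IsFiniteMeasure P] (X : Ω → 𝒳) (Y : Ω → 𝒴) (Z : Ω → 𝒵) : ℝ≥0∞ :=
  (∫⁻ z, InformationTheory.klDiv (condDistrib (fun ω => (X ω, Y ω)) Z P z)
      ((condDistrib X Z P z).prod (condDistrib Y Z P z)) ∂(P.map Z))
    / ENNReal.ofReal (Real.log 2)

/-- The model: one transmit antenna, `M` receive antennas, frame length `L`, `K` radar targets,
two communication users, on a probability space `(Ω, P)`. -/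
structure Model {Ω : Type*} [MeasurableSpace Ω] (P : Measure Ω) (M L K : ℕ) where
  /-- power budget per time slot -/
  p : ℝ
  p_pos : 0 < p
  /-- power allocation factors of the near and of the far user -/
  αN : ℝ
  αF : ℝ
  αN_nonneg : 0 ≤ αN
  αN_lt_αF : αN < αF
  α_add : αN + αF = 1
  /-- noise variances for communications and for sensing -/
  σc2 : ℝ≥0
  σs2 : ℝ≥0
  σc2_pos : 0 < σc2
  σs2_pos : 0 < σs2
  /-- the two Rayleigh-fading channel coefficients -/
  ϱ₁ : ℝ≥0
  ϱ₂ : ℝ≥0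
  ϱ₁_pos : 0 < ϱ₁
  ϱ₂_pos : 0 < ϱ₂
  h₁ : Ω → ℂ
  h₂ : Ω → ℂ
  h₁_law : HasLaw h₁ (complexGaussian ϱ₁) P
  h₂_law : HasLaw h₂ (complexGaussian ϱ₂) P
  h_indep : IndepFun h₁ h₂ P
  /-- receive array steering vector as a function of the angle of arrival -/
  a : ℝ → Fin M → ℂ
  /-- angles of arrival and average strengths of the targets -/
  θ : Fin K → ℝ
  σ2 : Fin K → ℝ≥0
  /-- complex amplitudes of the targets -/
  β : Fin K → Ω → ℂ
  β_law : ∀ k, HasLaw (β k) (complexGaussian (σ2 k)) P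
  /-- white Gaussian noise at the sensing receiver (full bandwidth) -/
  Ns : Fin M → Fin L → Ω → ℂ
  Ns_law : ∀ m l, HasLaw (Ns m l) (complexGaussian σs2) P
  /-- all amplitudes and all noise entries are mutually independent -/
  βNs_indep : iIndepFun (Sum.elim β (fun ml : Fin M × Fin L => Ns ml.1 ml.2)) P
  /-- the two unit-power data streams, mutually orthogonal over the frame, and independent of
  the targets and of the noise -/
  S : Ω → Matrix (Fin 2) (Fin L) ℂ
  S_meas : ∀ u l, Measurable (fun ω => S ω u l)
  S_gram : ∀ᵐ ω ∂P, S ω * (S ω)ᴴ = (L : ℂ) • (1 : Matrix (Fin 2) (Fin 2) ℂ)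
  S_indep : IndepFun (fun ω u l => S ω u l)
    (fun ω => ((fun k => β k ω), (fun m l => Ns m l ω))) P
  /-- the unit-power radar-only waveform of the frequency-division scheme, independent of the
  targets and of the noise -/
  s : Ω → Fin L → ℂ
  s_meas : Measurable s
  s_power : ∀ᵐ ω ∂P, ∑ l, ‖s ω l‖ ^ 2 = (L : ℝ)
  s_indep : IndepFun s (fun ω => ((fun k => β k ω), (fun m l => Ns m l ω))) P

namespace Model

variable {Ω : Type*} [MeasurableSpace Ω] {P : Measure Ω} {M L K : ℕ}

/-! ### Communications. `κ` is the fraction of the bandwidth and `μ` the fraction of the power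
that communications use. -/

/-- `|h_N| ^ 2` -/
def gainN (𝓜 : Model P M L K) (ω : Ω) : ℝ := (max ‖𝓜.h₁ ω‖ ‖𝓜.h₂ ω‖) ^ 2

/-- `|h_F| ^ 2` -/
def gainF (𝓜 : Model P M L K) (ω : Ω) : ℝ := (min ‖𝓜.h₁ ω‖ ‖𝓜.h₂ ω‖) ^ 2

/-- SNR of the near user for its own message, after interference cancellation -/
def snrN (𝓜 : Model P M L K) (κ μ : ℝ) (ω : Ω) : ℝ :=
  μ * 𝓜.p * 𝓜.gainN ω * 𝓜.αN / (κ * 𝓜.σc2)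

/-- SINR of the far user -/
def sinrF (𝓜 : Model P M L K) (κ μ : ℝ) (ω : Ω) : ℝ :=
  μ * 𝓜.p * 𝓜.gainF ω * 𝓜.αF / (κ * 𝓜.σc2 + μ * 𝓜.p * 𝓜.gainF ω * 𝓜.αN)

/-- ergodic rate of the near user: the expectation of a non-negative variable -/
def ergodicRateN (𝓜 : Model P M L K) (κ μ : ℝ) : ℝ≥0∞ :=
  ∫⁻ ω, ENNReal.ofReal (κ * Real.logb 2 (1 + 𝓜.snrN κ μ ω)) ∂P

/-- ergodic rate of the far user -/
def ergodicRateF (𝓜 : Model P M L K) (κ μ : ℝ) : ℝ≥0∞ :=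
  ∫⁻ ω, ENNReal.ofReal (κ * Real.logb 2 (1 + 𝓜.sinrF κ μ ω)) ∂P

/-- sum ergodic communication rate -/
def commRate (𝓜 : Model P M L K) (κ μ : ℝ) : ℝ≥0∞ :=
  𝓜.ergodicRateN κ μ + 𝓜.ergodicRateF κ μ

/-! ### Sensing -/

/-- target response vector -/
def g (𝓜 : Model P M L K) (ω : Ω) : Fin M → ℂ :=
  fun m => ∑ k, 𝓜.β k ω * 𝓜.a (𝓜.θ k) m

/-- The echo `g xᵀ + N` of the waveform `x`, received in a fraction `b` of the bandwidth, so
that the entries of the white noise have variance `b σ_s²`. -/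
def echo (𝓜 : Model P M L K) (b : ℝ) (x : Ω → Fin L → ℂ) (ω : Ω) : Fin M → Fin L → ℂ :=
  fun m l => 𝓜.g ω m * x ω l + (Real.sqrt b : ℂ) * 𝓜.Ns m l ω

/-- Sensing rate in a fraction `b` of the bandwidth with the waveform `x`. -/
def sensingRate [IsFiniteMeasure P] (𝓜 : Model P M L K) (b : ℝ) (x : Ω → Fin L → ℂ) : ℝ≥0∞ :=
  ENNReal.ofReal (b / L) * condMutualInfo P (𝓜.echo b x) 𝓜.g x

/-- dual-functional waveform `xᵀ = √p [√α_N, √α_F] S` -/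
def isacWaveform (𝓜 : Model P M L K) (ω : Ω) : Fin L → ℂ :=
  fun l => (Real.sqrt 𝓜.p : ℂ) *
    ((Real.sqrt 𝓜.αN : ℂ) * 𝓜.S ω 0 l + (Real.sqrt 𝓜.αF : ℂ) * 𝓜.S ω 1 l)

/-- radar-only waveform of power `(1 - μ) p` -/
def fdsacWaveform (𝓜 : Model P M L K) (μ : ℝ) (ω : Ω) : Fin L → ℂ :=
  fun l => (Real.sqrt ((1 - μ) * 𝓜.p) : ℂ) * 𝓜.s ω l

/-! ### Rate regions: sets of pairs (sensing rate, sum communication rate) -/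

def isacRegion [IsFiniteMeasure P] (𝓜 : Model P M L K) : Set (ℝ≥0 × ℝ≥0) :=
  {q | (q.1 : ℝ≥0∞) ≤ 𝓜.sensingRate 1 𝓜.isacWaveform ∧ (q.2 : ℝ≥0∞) ≤ 𝓜.commRate 1 1}

def fdsacRegion [IsFiniteMeasure P] (𝓜 : Model P M L K) : Set (ℝ≥0 × ℝ≥0) :=
  {q | ∃ κ ∈ Icc (0 : ℝ) 1, ∃ μ ∈ Icc (0 : ℝ) 1,
    (q.1 : ℝ≥0∞) ≤ 𝓜.sensingRate (1 - κ) (𝓜.fdsacWaveform μ) ∧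
    (q.2 : ℝ≥0∞) ≤ 𝓜.commRate κ μ}

end Model

end NomaIsac

end

noncomputable section

namespace NomaIsac

/-! The region of ISAC is a rectangle, so it suffices that each of its two rates dominates the
corresponding rate of FDSAC for every split `(κ, μ)`. Both comparisons rest on Bernoulli's
inequality `(1 + x) ^ κ ≤ 1 + κ x`, that is, `κ log (1 + x) ≤ log (1 + κ x)`: shrinking the band by
`κ` costs at least as much in the prefactor as it gains by concentrating the power on less noise.

For communications the comparison is pointwise in the channel: `κ γ(κ, μ) ≤ γ(1, 1)` for both users.

For sensing the mutual information is computed exactly. Given the waveform, the echo is a Gaussian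
channel with input `g`. In a real orthonormal eigenbasis of the covariance of `g` the coordinates
are independent, with variances `l j`, and the directions `e j zᵀ` stay orthogonal with equal
lengths. The information is therefore `∑ j, 1/2 * log (1 + q / (b σ_s² / 2) * l j)`, where the
waveform enters only through its energy `q` (`HasShiftDensity.klDiv_channel`,
`exists_condMutualInfo_eq`). The energies are `p L` and `(1 - μ) p L`, both almost surely constant,
and Bernoulli applies term by term. -/

lemma mul_log_one_add_le {κ x : ℝ} (h0 : 0 ≤ κ) (h1 : κ ≤ 1) (hx : 0 ≤ x) :
    κ * Real.log (1 + x) ≤ Real.log (1 + κ * x) := by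
  rw [← Real.log_rpow (by positivity)]
  exact Real.log_le_log (by positivity) (rpow_one_add_le_one_add_mul_self (by linarith) h0 h1)

lemma mul_logb_one_add_le {κ x : ℝ} (h0 : 0 ≤ κ) (h1 : κ ≤ 1) (hx : 0 ≤ x) :
    κ * Real.logb 2 (1 + x) ≤ Real.logb 2 (1 + κ * x) := by
  have h2 : 0 < Real.log 2 := Real.log_pos (by norm_num)
  rw [Real.logb, Real.logb, ← mul_div_assoc]
  gcongr
  exact mul_log_one_add_le h0 h1 hx

lemma mul_logb_one_add_le_of_mul_le {κ x y : ℝ} (h0 : 0 ≤ κ) (h1 : κ ≤ 1) (hx : 0 ≤ x)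
    (h : κ * x ≤ y) : κ * Real.logb 2 (1 + x) ≤ Real.logb 2 (1 + y) :=
  (mul_logb_one_add_le h0 h1 hx).trans
    (Real.logb_le_logb_of_le (by norm_num) (by positivity) (by linarith))

/-! ### Communication rates: comparison for each channel realisation -/

namespace Model

variable {Ω : Type*} [MeasurableSpace Ω] {P : Measure Ω} {M L K : ℕ}

lemma gainN_nonneg (𝓜 : Model P M L K) (ω : Ω) : 0 ≤ 𝓜.gainN ω := sq_nonneg _

lemma gainF_nonneg (𝓜 : Model P M L K) (ω : Ω) : 0 ≤ 𝓜.gainF ω := sq_nonneg _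

lemma αF_nonneg (𝓜 : Model P M L K) : 0 ≤ 𝓜.αF := 𝓜.αN_nonneg.trans 𝓜.αN_lt_αF.le

lemma ergodicRateN_le (𝓜 : Model P M L K) {κ μ : ℝ} (hκ : κ ∈ Icc (0 : ℝ) 1)
    (hμ : μ ∈ Icc (0 : ℝ) 1) : 𝓜.ergodicRateN κ μ ≤ 𝓜.ergodicRateN 1 1 := by
  refine lintegral_mono fun ω => ENNReal.ofReal_le_ofReal ?_
  have hp := 𝓜.p_pos
  have hg := 𝓜.gainN_nonneg ω
  have ha := 𝓜.αN_nonneg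
  have hs : (0 : ℝ) < 𝓜.σc2 := 𝓜.σc2_pos
  obtain ⟨hκ0, hκ1⟩ := hκ
  obtain ⟨hμ0, hμ1⟩ := hμ
  rw [one_mul]
  refine mul_logb_one_add_le_of_mul_le hκ0 hκ1 (by unfold snrN; positivity) ?_
  unfold snrN
  -- At `κ = 0` the quotient is a division by zero, so `κ` cannot be cancelled; the prefactor makes
  -- the left side zero.
  rcases hκ0.eq_or_lt with rfl | hκ
  · rw [zero_mul]; positivity
  · calc κ * (μ * 𝓜.p * 𝓜.gainN ω * 𝓜.αN / (κ * 𝓜.σc2))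
        = μ * (𝓜.p * 𝓜.gainN ω * 𝓜.αN / 𝓜.σc2) := by field_simp
      _ ≤ 1 * (𝓜.p * 𝓜.gainN ω * 𝓜.αN / 𝓜.σc2) := by gcongr
      _ = _ := by ring

lemma ergodicRateF_le (𝓜 : Model P M L K) {κ μ : ℝ} (hκ : κ ∈ Icc (0 : ℝ) 1)
    (hμ : μ ∈ Icc (0 : ℝ) 1) : 𝓜.ergodicRateF κ μ ≤ 𝓜.ergodicRateF 1 1 := by
  refine lintegral_mono fun ω => ENNReal.ofReal_le_ofReal ?_
  have hp := 𝓜.p_pos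
  have hg := 𝓜.gainF_nonneg ω
  have ha := 𝓜.αN_nonneg
  have hF := 𝓜.αF_nonneg
  have hs : (0 : ℝ) < 𝓜.σc2 := 𝓜.σc2_pos
  obtain ⟨hκ0, hκ1⟩ := hκ
  obtain ⟨hμ0, hμ1⟩ := hμ
  rw [one_mul]
  refine mul_logb_one_add_le_of_mul_le hκ0 hκ1 (by unfold sinrF; positivity) ?_
  unfold sinrF
  rcases hκ0.eq_or_lt with rfl | hκ
  · rw [zero_mul]; positivity
  · set t := 𝓜.p * 𝓜.gainF ω with ht
    have ht0 : 0 ≤ t := by positivity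
    have e : μ * 𝓜.p * 𝓜.gainF ω = μ * t := by rw [ht]; ring
    have e1 : 1 * 𝓜.p * 𝓜.gainF ω = t := by rw [ht]; ring
    -- After cross-multiplication the gap is `t αF` times `κ σ_c² (1 - μ) + (1 - κ) μ t αN`; these
    -- two parts are `h2` and `h3`.
    rw [e, e1, one_mul, ← mul_div_assoc, div_le_div_iff₀ (by positivity) (by positivity)]
    have h1 : 0 ≤ κ * t * 𝓜.αF * (𝓜.σc2 * (1 - μ) * κ) :=
      mul_nonneg (by positivity) (mul_nonneg (mul_nonneg hs.le (by linarith)) hκ0)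
    have h2 : 0 ≤ t * 𝓜.αF * (𝓜.σc2 * (1 - μ) * κ) :=
      mul_nonneg (by positivity) (mul_nonneg (mul_nonneg hs.le (by linarith)) hκ0)
    have h3 : 0 ≤ (1 - κ) * (t * 𝓜.αF * (μ * t * 𝓜.αN)) :=
      mul_nonneg (by linarith) (by positivity)
    nlinarith

lemma commRate_le (𝓜 : Model P M L K) {κ μ : ℝ} (hκ : κ ∈ Icc (0 : ℝ) 1)
    (hμ : μ ∈ Icc (0 : ℝ) 1) : 𝓜.commRate κ μ ≤ 𝓜.commRate 1 1 :=
  add_le_add (𝓜.ergodicRateN_le hκ hμ) (𝓜.ergodicRateF_le hκ hμ)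

end Model

/-! ### Gaussian densities -/

lemma gaussianReal_map_add_eq_withDensity {v : ℝ≥0} (hv : v ≠ 0) (w : ℝ) :
    (gaussianReal 0 v).map (· + w) = (gaussianReal 0 v).withDensity
      (fun y => ENNReal.ofReal (Real.exp ((w * y - w ^ 2 / 2) / v))) := by
  have hv' : (v : ℝ) ≠ 0 := by exact_mod_cast hv
  rw [gaussianReal_map_add_const, zero_add, gaussianReal_of_var_ne_zero _ hv,
    gaussianReal_of_var_ne_zero _ hv, ← withDensity_mul _ (by fun_prop) (by fun_prop)]
  congr 1
  ext y
  simp only [Pi.mul_apply, gaussianPDF, gaussianPDFReal]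
  rw [← ENNReal.ofReal_mul (by positivity), mul_assoc (_⁻¹), ← Real.exp_add]
  congr 3
  field_simp
  ring

/-- Completing the square: the tilted density is a multiple of the Gaussian density of variance `r =
l / (1 + s l)` and mean `r u`, the posterior of the input given the observation. The case `l = 0` is
a point mass at zero. -/
lemma lintegral_exp_quadratic_gaussianReal (l : ℝ≥0) {s : ℝ} (hs : 0 ≤ s) (u : ℝ) :
    ∫⁻ x, ENNReal.ofReal (Real.exp (u * x - s / 2 * x ^ 2)) ∂(gaussianReal 0 l) =
      ENNReal.ofReal (Real.exp (l * u ^ 2 / (2 * (1 + s * l)) - 1 / 2 * Real.log (1 + s * l))) := by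
  rcases eq_or_ne l 0 with rfl | hl
  · simp
  have hl' : (0 : ℝ) < l := by exact_mod_cast pos_iff_ne_zero.2 hl
  have h1 : 0 < 1 + s * l := by positivity
  set r : ℝ≥0 := ⟨l / (1 + s * l), by positivity⟩ with hr
  have hr' : (r : ℝ) = l / (1 + s * l) := rfl
  have hr0 : r ≠ 0 := by
    rw [← NNReal.coe_ne_zero, hr']; positivity
  rw [gaussianReal_of_var_ne_zero _ hl, lintegral_withDensity_eq_lintegral_mul _ (by fun_prop)
    (by fun_prop)]
  have key : ∀ x, (gaussianPDF 0 l * fun x => ENNReal.ofReal (Real.exp (u * x - s / 2 * x ^ 2))) x =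
      ENNReal.ofReal (Real.exp (l * u ^ 2 / (2 * (1 + s * l)) - 1 / 2 * Real.log (1 + s * l))) *
        gaussianPDF (r * u) r x := by
    intro x
    simp only [Pi.mul_apply, gaussianPDF, gaussianPDFReal]
    rw [← ENNReal.ofReal_mul (by positivity), ← ENNReal.ofReal_mul (by positivity)]
    congr 1
    have e : Real.exp (-(1 / 2 * Real.log (1 + s * l))) = (√(1 + s * l))⁻¹ := by
      rw [Real.exp_neg, mul_comm, Real.exp_mul, Real.exp_log h1, Real.sqrt_eq_rpow]
    have e2 : √(2 * Real.pi * r) = √(2 * Real.pi * l) / √(1 + s * l) := by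
      rw [hr', ← mul_div_assoc, Real.sqrt_div (by positivity)]
    rw [sub_eq_add_neg (l * u ^ 2 / _), Real.exp_add, e, e2, mul_assoc, ← Real.exp_add]
    have h2 : √(1 + s * l) ≠ 0 := by positivity
    have h3 : √(2 * Real.pi * l) ≠ 0 := by positivity
    have e3 : Real.exp (-(x - 0) ^ 2 / (2 * l) + (u * x - s / 2 * x ^ 2)) =
      Real.exp (l * u ^ 2 / (2 * (1 + s * l))) * Real.exp (-(x - r * u) ^ 2 / (2 * r)) := by
      rw [← Real.exp_add, hr']
      congr 1
      field_simp
      ring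
    rw [e3]
    field_simp
  simp_rw [key]
  rw [lintegral_const_mul _ (by fun_prop), lintegral_gaussianPDF_eq_one _ hr0, mul_one]

/-- Translating the factors of a product measure by vectors for which they have a density. -/
lemma pi_map_add_eq_withDensity {ι : Type*} [Fintype ι] {E : Type*} [AddCommGroup E]
    [MeasurableSpace E] [MeasurableAdd E] (μ : ι → Measure E)
    [∀ i, IsProbabilityMeasure (μ i)] (w : ι → E) (f : ι → E → ℝ≥0∞)
    (hf : ∀ i, Measurable (f i))
    (h : ∀ i, (μ i).map (· + w i) = (μ i).withDensity (f i)) :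
    (Measure.pi μ).map (· + w) = (Measure.pi μ).withDensity (fun y => ∏ i, f i (y i)) := by
  have hmap : (Measure.pi μ).map (· + w) = Measure.pi fun i => (μ i).map (· + w i) :=
    (Measure.pi_map_pi (μ := μ) (f := fun i x => x + w i) fun i => by fun_prop)
  have (i : ι) : IsProbabilityMeasure ((μ i).map (· + w i)) :=
    Measure.isProbabilityMeasure_map (by fun_prop)
  rw [hmap]
  refine (Measure.pi_eq fun t ht => ?_)
  rw [withDensity_apply _ (MeasurableSet.univ_pi ht), ← lintegral_indicator (MeasurableSet.univ_pi ht)]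
  have hind : iIndepFun (fun i (y : ι → E) => (t i).indicator (f i) (y i)) (Measure.pi μ) :=
    iIndepFun_pi (fun i => ((hf i).indicator (ht i)).aemeasurable)
  have e : ∀ y : ι → E, (univ.pi t).indicator (fun y => ∏ i, f i (y i)) y =
      ∏ i, (t i).indicator (f i) (y i) := by
    intro y
    by_cases hy : y ∈ univ.pi t
    · rw [indicator_of_mem hy]
      exact Finset.prod_congr rfl fun i _ => (indicator_of_mem (hy i (mem_univ i)) _).symm
    · rw [indicator_of_notMem hy]
      simp only [mem_pi, mem_univ, true_imp_iff, not_forall] at hy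
      obtain ⟨i, hi⟩ := hy
      exact (Finset.prod_eq_zero (Finset.mem_univ i) (indicator_of_notMem hi _)).symm
  simp_rw [e]
  rw [lintegral_prod_eq_prod_lintegral_of_indepFun _ _ hind
    fun i => ((hf i).indicator (ht i)).comp (measurable_pi_apply i)]
  refine Finset.prod_congr rfl fun i _ => ?_
  rw [h i, withDensity_apply _ (ht i), ← lintegral_indicator (ht i),
    ← (measurePreserving_eval μ i).lintegral_comp ((hf i).indicator (ht i))]

open InformationTheory in
-- The log-likelihood ratio is `F`, so the divergence is its mean under `J`; the mass correction in
-- `klDiv` cancels between probability measures.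
lemma klDiv_withDensity_exp {α : Type*} [MeasurableSpace α] (ρ J : Measure α)
    [IsProbabilityMeasure ρ] [IsProbabilityMeasure J] {F : α → ℝ} (hF : Measurable F)
    (hJ : J = ρ.withDensity (fun x => ENNReal.ofReal (Real.exp (F x)))) (hint : Integrable F J) :
    klDiv J ρ = ENNReal.ofReal (∫ x, F x ∂J) := by
  have hac : J ≪ ρ := hJ ▸ withDensity_absolutelyContinuous _ _
  have hrn : J.rnDeriv ρ =ᵐ[ρ] fun x => ENNReal.ofReal (Real.exp (F x)) := by
    rw [hJ]; exact Measure.rnDeriv_withDensity ρ (by fun_prop)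
  have hllr : llr J ρ =ᵐ[J] F := by
    filter_upwards [hac.ae_le hrn] with x hx
    rw [llr, hx, ENNReal.toReal_ofReal (Real.exp_nonneg _), Real.log_exp]
  rw [klDiv_of_ac_of_integrable hac (hint.congr hllr.symm), integral_congr_ae hllr]
  simp

/-- Equality of everywhere defined moment generating functions with those of a Gaussian. -/
lemma hasLaw_gaussianReal_of_lintegral_exp {α : Type*} [MeasurableSpace α] {ν : Measure α}
    [IsProbabilityMeasure ν] {X : α → ℝ} (hX : Measurable X) (r : ℝ≥0)
    (h : ∀ t : ℝ, ∫⁻ y, ENNReal.ofReal (Real.exp (t * X y)) ∂ν =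
      ENNReal.ofReal (Real.exp (r * t ^ 2 / 2))) :
    HasLaw X (gaussianReal 0 r) ν := by
  have hint (t : ℝ) : Integrable (fun y => Real.exp (t * X y)) ν := by
    refine ⟨by fun_prop, ?_⟩
    rw [hasFiniteIntegral_iff_ofReal (Filter.Eventually.of_forall fun _ => Real.exp_nonneg _), h t]
    exact ENNReal.ofReal_lt_top
  have hmgf : mgf X ν = mgf id (gaussianReal 0 r) := by
    ext t
    rw [mgf_id_gaussianReal, mgf, integral_eq_lintegral_of_nonneg_ae
      (Filter.Eventually.of_forall fun _ => Real.exp_nonneg _) (hint t).aestronglyMeasurable, h t,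
      ENNReal.toReal_ofReal (Real.exp_nonneg _)]
    simp
  have hset : integrableExpSet X ν = univ := eq_univ_of_forall hint
  refine ⟨hX.aemeasurable, ?_⟩
  have := Measure.ext_of_complexMGF_eq hX.aemeasurable aemeasurable_id
    (funext fun z => eqOn_complexMGF_of_mgf hmgf (by simp [hset]))
  rwa [Measure.map_id] at this

lemma integral_of_hasLaw_gaussianReal {α : Type*} [MeasurableSpace α] {m : Measure α} {X : α → ℝ}
    {r : ℝ≥0} (h : HasLaw X (gaussianReal 0 r) m) :
    Integrable X m ∧ ∫ x, X x ∂m = 0 ∧ Integrable (fun x => X x ^ 2) m ∧ ∫ x, X x ^ 2 ∂m = r := by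
  have : IsProbabilityMeasure m := h.isProbabilityMeasure
  have hL : MemLp X 2 m := by
    have := memLp_id_gaussianReal' (μ := 0) (v := r) 2 (by simp)
    rw [← h.map_eq] at this
    exact (memLp_map_measure_iff (by fun_prop) h.aemeasurable).1 this
  have h0 : ∫ x, X x ∂m = 0 := by
    rw [h.integral_eq, integral_id_gaussianReal]
  refine ⟨hL.integrable (by norm_num), h0, hL.integrable_sq, ?_⟩
  have hv := h.variance_eq
  rwa [variance_id_gaussianReal, variance_of_integral_eq_zero h.aemeasurable h0] at hv

/-! ### Mutual information of a Gaussian channel from translation densities -/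

section Channel

variable {𝒳 𝒴 κ : Type*} [MeasurableSpace 𝒳] [AddCommGroup 𝒴] [Module ℝ 𝒴] [MeasurableSpace 𝒴]
  [MeasurableAdd₂ 𝒴]

/-- The measure `ν` transforms under translations like a centred Gaussian measure whose
Cameron-Martin form is `B`. -/
def HasShiftDensity (ν : Measure 𝒴) (B : 𝒴 →ₗ[ℝ] 𝒴 →ₗ[ℝ] ℝ) : Prop :=
  ∀ w, Measurable (B w) ∧ ν.map (· + w) =
    ν.withDensity (fun y => ENNReal.ofReal (Real.exp (B w y - B w w / 2)))

/-- Every translate of `ν` has mass one. For the translate by `t • w` this says that `exp (t B(w, y)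
- t² B(w, w) / 2)` has integral one, which is the Gaussian moment generating function. -/
lemma HasShiftDensity.hasLaw {ν : Measure 𝒴} [IsProbabilityMeasure ν] {B : 𝒴 →ₗ[ℝ] 𝒴 →ₗ[ℝ] ℝ}
    (h : HasShiftDensity ν B) (w : 𝒴) (r : ℝ≥0) (hr : B w w = r) :
    HasLaw (B w) (gaussianReal 0 r) ν := by
  have hm := (h w).1
  refine hasLaw_gaussianReal_of_lintegral_exp hm r fun t => ?_
  have h1 := congrArg (fun m => m univ) (h (t • w)).2
  simp only [Measure.map_apply (measurable_add_const (t • w)) MeasurableSet.univ, preimage_univ,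
    measure_univ, withDensity_apply _ MeasurableSet.univ, Measure.restrict_univ, map_smul,
    LinearMap.smul_apply, smul_eq_mul, hr, sub_eq_add_neg, Real.exp_add,
    ENNReal.ofReal_mul (Real.exp_nonneg _)] at h1
  rw [lintegral_mul_const _ (by fun_prop)] at h1
  rw [ENNReal.eq_inv_of_mul_eq_one_left h1.symm, ← ENNReal.ofReal_inv_of_pos (Real.exp_pos _),
    ← Real.exp_neg]
  congr 2
  ring

variable [Fintype κ] [DecidableEq κ]

/-- For a fixed input `x` the output is the noise translated by `w x`, so the translation density
applies on each fibre. This gives the joint law of output and input relative to independent noise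
and input. -/
lemma HasShiftDensity.map_prod_eq_withDensity {ν : Measure 𝒴} [IsProbabilityMeasure ν]
    {B : 𝒴 →ₗ[ℝ] 𝒴 →ₗ[ℝ] ℝ} (h : HasShiftDensity ν B) (γ : Measure 𝒳) [IsProbabilityMeasure γ]
    {w : 𝒳 → 𝒴} (hw : Measurable w) (hB : Measurable fun q : 𝒴 × 𝒳 => B (w q.2) q.1)
    (hB' : Measurable fun x => B (w x) (w x)) :
    (ν.prod γ).map (fun q => (q.1 + w q.2, q.2)) = (ν.prod γ).withDensity
      (fun q => ENNReal.ofReal (Real.exp (B (w q.2) q.1 - B (w q.2) (w q.2) / 2))) := by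
  have hB2 : Measurable fun q : 𝒴 × 𝒳 => B (w q.2) (w q.2) := hB'.comp measurable_snd
  have hL : Measurable fun q : 𝒴 × 𝒳 =>
      ENNReal.ofReal (Real.exp (B (w q.2) q.1 - B (w q.2) (w q.2) / 2)) :=
    (Real.measurable_exp.comp (hB.sub (hB2.div_const 2))).ennreal_ofReal
  refine Measure.ext_of_lintegral _ fun f hf => ?_
  rw [lintegral_map hf (by fun_prop), lintegral_withDensity_eq_lintegral_mul _ hL hf,
    lintegral_prod_symm' _ (by fun_prop), lintegral_prod_symm' _ (hL.mul hf)]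
  refine lintegral_congr fun x => ?_
  have hBx : Measurable (B (w x)) := (h (w x)).1
  have : Measurable fun y => f (y, x) := by fun_prop
  rw [← lintegral_map (f := fun y => f (y, x)) this (measurable_add_const (w x)), (h (w x)).2,
    lintegral_withDensity_eq_lintegral_mul _ (by fun_prop) this]
  rfl

/-- The mutual information of a vector Gaussian channel whose directions `f j` are orthogonal and
of the same length: each independent coordinate `c j` of the input, of variance `l j`, contributes
`log (1 + s * l j) / 2` nats. -/
theorem HasShiftDensity.klDiv_channel {ν : Measure 𝒴} [IsProbabilityMeasure ν]
    {B : 𝒴 →ₗ[ℝ] 𝒴 →ₗ[ℝ] ℝ} (h : HasShiftDensity ν B) (γ : Measure 𝒳) [IsProbabilityMeasure γ]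
    {c : κ → 𝒳 → ℝ} (hc : ∀ j, Measurable (c j)) (hcind : iIndepFun c γ) (l : κ → ℝ≥0)
    (hcl : ∀ j, HasLaw (c j) (gaussianReal 0 (l j)) γ) (s : ℝ≥0) (f : κ → 𝒴)
    (hf : ∀ j k, B (f j) (f k) = if j = k then (s : ℝ) else 0)
    {w : 𝒳 → 𝒴} (hw : Measurable w) (hwf : ∀ x, w x = ∑ j, c j x • f j) :
    InformationTheory.klDiv ((ν.prod γ).map (fun q => (q.1 + w q.2, q.2)))
      (((ν.prod γ).map (fun q => q.1 + w q.2)).prod γ) =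
      ENNReal.ofReal (∑ j, 1 / 2 * Real.log (1 + s * l j)) := by
  have hBf (j) : Measurable (B (f j)) := (h (f j)).1
  have hBw (x y) : B (w x) y = ∑ j, c j x * B (f j) y := by
    simp [hwf, LinearMap.sum_apply]
  have hfw (j x) : B (f j) (w x) = s * c j x := by
    simp [hwf, hf, mul_comm]
  have hww (x) : B (w x) (w x) = ∑ j, s * c j x ^ 2 := by
    rw [hBw]
    refine Finset.sum_congr rfl fun j _ => ?_
    rw [hfw]; ring
  -- `D j u x` is the log-likelihood of the input coordinate `x` when the statistic `B (f j)` of the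
  -- output is `u`; `Z j u` is the logarithm of the average of `exp (D j u x)` over `x ∼ N(0, l j)`.
  set D : κ → ℝ → ℝ → ℝ := fun j u x => u * x - s / 2 * x ^ 2 with hD
  set Z : κ → ℝ → ℝ := fun j u =>
    l j * u ^ 2 / (2 * (1 + s * l j)) - 1 / 2 * Real.log (1 + s * l j) with hZ
  set J := (ν.prod γ).map (fun q => (q.1 + w q.2, q.2)) with hJdef
  have hΦ : Measurable fun q : 𝒴 × 𝒳 => (q.1 + w q.2, q.2) := by fun_prop
  have hJ : J = (ν.prod γ).withDensity
      (fun q => ENNReal.ofReal (Real.exp (∑ j, D j (B (f j) q.1) (c j q.2)))) := by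
    rw [hJdef, h.map_prod_eq_withDensity γ hw (by simp_rw [hBw]; fun_prop)
      (by simp_rw [hww]; fun_prop)]
    congr 1
    ext q
    rw [hBw, hww, Finset.sum_div, ← Finset.sum_sub_distrib]
    congr 3
    ext j
    simp only [hD]; ring
  have : IsProbabilityMeasure J := Measure.isProbabilityMeasure_map hΦ.aemeasurable
  have hYJ : (ν.prod γ).map (fun q => q.1 + w q.2) = J.map Prod.fst := by
    rw [hJdef, Measure.map_map measurable_fst hΦ]; rfl
  -- The output density is the joint density integrated over the input; independence of the
  -- coordinates factors the integral.
  have hY : (ν.prod γ).map (fun q => q.1 + w q.2) =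
      ν.withDensity (fun y => ENNReal.ofReal (Real.exp (∑ j, Z j (B (f j) y)))) := by
    rw [hYJ, hJ]
    refine Measure.ext_of_lintegral _ fun φ hφ => ?_
    rw [lintegral_map hφ measurable_fst, lintegral_withDensity_eq_lintegral_mul _
      (by simp only [hD]; fun_prop) (by fun_prop), lintegral_withDensity_eq_lintegral_mul _
      (by simp only [hZ]; fun_prop) (by fun_prop), lintegral_prod _
      (by simp only [hD]; fun_prop)]
    refine lintegral_congr fun y => ?_
    simp only [Pi.mul_apply]
    rw [lintegral_mul_const _ (by simp only [hD]; fun_prop)]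
    congr 1
    simp_rw [Real.exp_sum, ENNReal.ofReal_prod_of_nonneg fun _ _ => Real.exp_nonneg _]
    rw [lintegral_prod_eq_prod_lintegral_of_indepFun _
      (fun j x => ENNReal.ofReal (Real.exp (D j (B (f j) y) (c j x))))
      (hcind.comp (fun j t => ENNReal.ofReal (Real.exp (D j (B (f j) y) t)))
        fun j => by simp only [hD]; fun_prop) fun j => by simp only [hD]; fun_prop]
    refine Finset.prod_congr rfl fun j _ => ?_
    rw [(hcl j).lintegral_comp (f := fun t => ENNReal.ofReal (Real.exp (D j (B (f j) y) t)))
      (by simp only [hD]; fun_prop)]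
    exact lintegral_exp_quadratic_gaussianReal (l j) s.2 _
  have : IsProbabilityMeasure ((ν.prod γ).map (fun q => q.1 + w q.2)) :=
    Measure.isProbabilityMeasure_map (by fun_prop)
  set F : 𝒴 × 𝒳 → ℝ := fun q => ∑ j, (D j (B (f j) q.1) (c j q.2) - Z j (B (f j) q.1)) with hF
  have hFm : Measurable F := by simp only [hF, hD, hZ]; fun_prop
  have hJρ : J = (((ν.prod γ).map (fun q => q.1 + w q.2)).prod γ).withDensity
      (fun q => ENNReal.ofReal (Real.exp (F q))) := by
    rw [hY, prod_withDensity_left (by simp only [hZ]; fun_prop), ← withDensity_mul _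
      (by simp only [hZ]; fun_prop) (by fun_prop), hJ]
    congr 1
    ext q
    simp only [Pi.mul_apply]
    rw [← ENNReal.ofReal_mul (Real.exp_nonneg _), ← Real.exp_add, hF]
    simp only [Finset.sum_sub_distrib]
    congr 2
    ring
  -- Under the true law the statistic is `n + s x`, with `n` of variance `s` independent of `x`. The
  -- summand is then a quadratic in `(n, x)` plus the logarithm, and the mean of the quadratic is `s
  -- l / 2 - a s (1 + s l) = 0`.
  have hterm (j : κ) : Integrable (fun q : 𝒴 × 𝒳 =>
      D j (B (f j) (q.1 + w q.2)) (c j q.2) - Z j (B (f j) (q.1 + w q.2))) (ν.prod γ) ∧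
      ∫ q, D j (B (f j) (q.1 + w q.2)) (c j q.2) - Z j (B (f j) (q.1 + w q.2)) ∂(ν.prod γ) =
        1 / 2 * Real.log (1 + s * l j) := by
    obtain ⟨hx1, hx2, hx3, hx4⟩ := integral_of_hasLaw_gaussianReal (hcl j)
    obtain ⟨hn1, hn2, hn3, hn4⟩ := integral_of_hasLaw_gaussianReal
      (h.hasLaw (f j) s (by simp [hf]))
    have i1 : Integrable (fun q : 𝒴 × 𝒳 => c j q.2 ^ 2) (ν.prod γ) := hx3.comp_snd ν
    have i2 : Integrable (fun q : 𝒴 × 𝒳 => B (f j) q.1 ^ 2) (ν.prod γ) := hn3.comp_fst γ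
    have i3 : Integrable (fun q : 𝒴 × 𝒳 => B (f j) q.1 * c j q.2) (ν.prod γ) := hn1.mul_prod hx1
    have v1 : ∫ q : 𝒴 × 𝒳, c j q.2 ^ 2 ∂(ν.prod γ) = l j := by
      rw [integral_fun_snd (fun x => c j x ^ 2), hx4]; simp
    have v2 : ∫ q : 𝒴 × 𝒳, B (f j) q.1 ^ 2 ∂(ν.prod γ) = s := by
      rw [integral_fun_fst (fun y => B (f j) y ^ 2), hn4]; simp
    have v3 : ∫ q : 𝒴 × 𝒳, B (f j) q.1 * c j q.2 ∂(ν.prod γ) = 0 := by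
      rw [integral_prod_mul (fun y => B (f j) y) (c j), hn2, zero_mul]
    have h1 : (1 + s * l j : ℝ) ≠ 0 := by positivity
    set a : ℝ := l j / (2 * (1 + s * l j)) with ha
    have e : (fun q : 𝒴 × 𝒳 =>
        D j (B (f j) (q.1 + w q.2)) (c j q.2) - Z j (B (f j) (q.1 + w q.2))) = fun q =>
        ((s / 2 - a * s ^ 2) * c j q.2 ^ 2 + (1 - 2 * a * s) * (B (f j) q.1 * c j q.2)) +
          ((-a) * B (f j) q.1 ^ 2 + 1 / 2 * Real.log (1 + s * l j)) := by
      ext q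
      simp only [hD, hZ, map_add, hfw, ha]
      ring
    rw [e]
    have k1 := (i1.const_mul (s / 2 - a * s ^ 2)).add (i3.const_mul (1 - 2 * a * s))
    have k2 := (i2.const_mul (-a)).add
      (integrable_const (μ := ν.prod γ) (1 / 2 * Real.log (1 + s * l j)))
    refine ⟨k1.add k2, ?_⟩
    refine (integral_add k1 k2).trans ?_
    rw [integral_add' (i1.const_mul _) (i3.const_mul _),
      integral_add' (i2.const_mul _) (integrable_const _), integral_const_mul, integral_const_mul,
      integral_const_mul, v1, v2, v3, integral_const, probReal_univ, one_smul, ha]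
    field_simp
    ring
  have hint : Integrable F J := by
    rw [hJdef, integrable_map_measure hFm.aestronglyMeasurable hΦ.aemeasurable]
    exact integrable_finsetSum _ fun j _ => (hterm j).1
  rw [klDiv_withDensity_exp _ J hFm hJρ hint, hJdef,
    integral_map hΦ.aemeasurable hFm.aestronglyMeasurable]
  simp only [hF]
  rw [integral_finsetSum _ fun j _ => (hterm j).1]
  simp_rw [(hterm _).2]

end Channel

/-! ### Complex Gaussian laws and arrays with independent entries -/

open scoped RealInnerProductSpace

lemma measurable_complexMk : Measurable fun q : ℝ × ℝ => (⟨q.1, q.2⟩ : ℂ) :=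
  Complex.measurableEquivRealProd.symm.measurable

instance (v : ℝ≥0) : IsProbabilityMeasure (complexGaussian v) :=
  Measure.isProbabilityMeasure_map measurable_complexMk.aemeasurable

instance (v : ℝ≥0) : IsGaussian (complexGaussian v) :=
  isGaussian_map_equiv (μ := (gaussianReal 0 (v / 2)).prod (gaussianReal 0 (v / 2)))
    Complex.equivRealProdCLM.symm

lemma integral_id_complexGaussian (v : ℝ≥0) : ∫ z, z ∂(complexGaussian v) = 0 := by
  have hi : Integrable (fun x : ℝ => x) (gaussianReal 0 (v / 2)) :=
    (memLp_id_gaussianReal 1).integrable le_rfl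
  rw [complexGaussian, integral_map measurable_complexMk.aemeasurable
    (by fun_prop)]
  have e : (fun q : ℝ × ℝ => (⟨q.1, q.2⟩ : ℂ)) = fun q => (q.1 : ℂ) + (q.2 : ℂ) * Complex.I := by
    ext q; exact Complex.mk_eq_add_mul_I _ _
  have h1 : Integrable (fun q : ℝ × ℝ => (q.1 : ℂ))
      ((gaussianReal 0 (v / 2)).prod (gaussianReal 0 (v / 2))) := hi.ofReal.comp_fst _
  have h2 : Integrable (fun q : ℝ × ℝ => (q.2 : ℂ) * Complex.I)
      ((gaussianReal 0 (v / 2)).prod (gaussianReal 0 (v / 2))) :=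
    (hi.ofReal.comp_snd _).mul_const _
  have e0 : ∫ x : ℝ, (x : ℂ) ∂(gaussianReal 0 (v / 2)) = 0 := by
    rw [integral_complex_ofReal, integral_id_gaussianReal]; simp
  rw [e, integral_add h1 h2, integral_mul_const, integral_fun_fst (fun x : ℝ => (x : ℂ)),
    integral_fun_snd (fun x : ℝ => (x : ℂ)), e0]
  simp

lemma complexGaussian_map_add_eq_withDensity {v : ℝ≥0} (hv : v ≠ 0) (w : ℂ) :
    (complexGaussian v).map (· + w) = (complexGaussian v).withDensity
      (fun y => ENNReal.ofReal (Real.exp ((⟪w, y⟫ - ⟪w, w⟫ / 2) / (v / 2 : ℝ≥0)))) := by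
  have hv2 : v / 2 ≠ 0 := by positivity
  set μ := gaussianReal 0 (v / 2) with hμ
  have hadd : (fun y : ℂ => y + w) ∘ (fun q : ℝ × ℝ => (⟨q.1, q.2⟩ : ℂ)) =
      (fun q : ℝ × ℝ => (⟨q.1, q.2⟩ : ℂ)) ∘ Prod.map (· + w.re) (· + w.im) := by
    funext q; exact Complex.ext (by simp) (by simp)
  rw [complexGaussian, Measure.map_map (by fun_prop) measurable_complexMk, hadd,
    ← Measure.map_map measurable_complexMk (by fun_prop),
    ← Measure.map_prod_map _ _ (by fun_prop) (by fun_prop),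
    gaussianReal_map_add_eq_withDensity hv2, gaussianReal_map_add_eq_withDensity hv2,
    prod_withDensity (by fun_prop) (by fun_prop)]
  refine Measure.ext_of_lintegral _ fun f hf => ?_
  have hfm : Measurable fun q : ℝ × ℝ => f ⟨q.1, q.2⟩ := hf.comp measurable_complexMk
  rw [lintegral_map hf measurable_complexMk, lintegral_withDensity_eq_lintegral_mul _
    (by fun_prop) hfm, lintegral_withDensity_eq_lintegral_mul _ (by fun_prop) hf,
    lintegral_map (by fun_prop) measurable_complexMk]
  refine lintegral_congr fun q => ?_
  simp only [Pi.mul_apply]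
  rw [← ENNReal.ofReal_mul (Real.exp_nonneg _), ← Real.exp_add]
  congr 3
  simp only [Complex.inner, Complex.mul_re, Complex.conj_re, Complex.conj_im]
  ring

lemma complexGaussian_map_const_mul (v b : ℝ≥0) :
    (complexGaussian v).map (fun z => (Real.sqrt b : ℂ) * z) = complexGaussian (b * v) := by
  have h : (fun z => (Real.sqrt b : ℂ) * z) ∘ (fun q : ℝ × ℝ => (⟨q.1, q.2⟩ : ℂ)) =
      (fun q : ℝ × ℝ => (⟨q.1, q.2⟩ : ℂ)) ∘ Prod.map (Real.sqrt b * ·) (Real.sqrt b * ·) := by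
    funext q; exact Complex.ext (by simp) (by simp)
  have hv : (.mk (Real.sqrt b ^ 2) (sq_nonneg _) * (v / 2) : ℝ≥0) = b * v / 2 := by
    ext; simp [Real.sq_sqrt, mul_div_assoc]
  rw [complexGaussian, Measure.map_map (by fun_prop) measurable_complexMk, h,
    ← Measure.map_map measurable_complexMk (by fun_prop),
    ← Measure.map_prod_map _ _ (by fun_prop) (by fun_prop), gaussianReal_map_const_mul, mul_zero,
    hv]
  rfl

/-- The law of an array of independent `CN(0, v)` entries. -/
def arrayGaussian (M L : ℕ) (v : ℝ≥0) : Measure (Fin M → Fin L → ℂ) :=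
  Measure.pi fun _ => Measure.pi fun _ => complexGaussian v

instance (M L : ℕ) (v : ℝ≥0) : IsProbabilityMeasure (arrayGaussian M L v) := by
  unfold arrayGaussian; infer_instance

/-- The Cameron-Martin form of `arrayGaussian M L v`. -/
def arrayForm (M L : ℕ) (v : ℝ≥0) :
    (Fin M → Fin L → ℂ) →ₗ[ℝ] (Fin M → Fin L → ℂ) →ₗ[ℝ] ℝ :=
  LinearMap.mk₂ ℝ (fun w y => (∑ m, ∑ l, ⟪w m l, y m l⟫) / (v / 2 : ℝ≥0))
    (fun _ _ _ => by simp only [Pi.add_apply, inner_add_left, Finset.sum_add_distrib, add_div])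
    (fun _ _ _ => by
      simp only [Pi.smul_apply, real_inner_smul_left, ← Finset.mul_sum, mul_div_assoc, smul_eq_mul])
    (fun _ _ _ => by simp only [Pi.add_apply, inner_add_right, Finset.sum_add_distrib, add_div])
    (fun _ _ _ => by
      simp only [Pi.smul_apply, real_inner_smul_right, ← Finset.mul_sum, mul_div_assoc,
        smul_eq_mul])

lemma arrayForm_apply (M L : ℕ) (v : ℝ≥0) (w y : Fin M → Fin L → ℂ) :
    arrayForm M L v w y = (∑ m, ∑ l, ⟪w m l, y m l⟫) / (v / 2 : ℝ≥0) := rfl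

lemma hasShiftDensity_arrayGaussian (M L : ℕ) {v : ℝ≥0} (hv : v ≠ 0) :
    HasShiftDensity (arrayGaussian M L v) (arrayForm M L v) := by
  intro w
  refine ⟨?_, ?_⟩
  · have : ⇑(arrayForm M L v w) = fun y => (∑ m, ∑ l, ⟪w m l, y m l⟫) / (v / 2 : ℝ≥0) := rfl
    rw [this]
    fun_prop
  · have hrow (m : Fin M) := pi_map_add_eq_withDensity (fun _ : Fin L => complexGaussian v) (w m)
      (fun l y => ENNReal.ofReal (Real.exp ((⟪w m l, y⟫ - ⟪w m l, w m l⟫ / 2) / (v / 2 : ℝ≥0))))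
      (fun l => by fun_prop) fun l => complexGaussian_map_add_eq_withDensity hv (w m l)
    have harr := pi_map_add_eq_withDensity
      (fun _ : Fin M => Measure.pi fun _ : Fin L => complexGaussian v) w _
      (fun m => by fun_prop) hrow
    rw [arrayGaussian, harr]
    congr 1
    ext y
    simp_rw [← ENNReal.ofReal_prod_of_nonneg fun _ _ => Real.exp_nonneg _, ← Real.exp_sum]
    rw [← ENNReal.ofReal_prod_of_nonneg fun _ _ => Real.exp_nonneg _, ← Real.exp_sum,
      arrayForm_apply, arrayForm_apply]
    simp_rw [← Finset.sum_div, Finset.sum_sub_distrib, ← Finset.sum_div]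
    congr 2
    ring

/-- A conditional distribution given an independent variable. -/
lemma condDistrib_ae_eq_map_of_indepFun {Ω 𝒵 𝒲 𝒯 : Type*} [MeasurableSpace Ω] [MeasurableSpace 𝒵]
    [MeasurableSpace 𝒲] [MeasurableSpace 𝒯] [StandardBorelSpace 𝒯] [Nonempty 𝒯]
    {P : Measure Ω} [IsProbabilityMeasure P] {X : Ω → 𝒵} {W : Ω → 𝒲} (hX : AEMeasurable X P)
    (hW : AEMeasurable W P) (hind : IndepFun X W P) {f : 𝒵 × 𝒲 → 𝒯} (hf : Measurable f) :
    condDistrib (fun ω => f (X ω, W ω)) X P =ᵐ[P.map X]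
      fun z => (P.map W).map (fun w => f (z, w)) := by
  have : IsProbabilityMeasure (P.map W) := Measure.isProbabilityMeasure_map hW
  set η : Kernel 𝒵 𝒯 := (Kernel.id ×ₖ Kernel.const 𝒵 (P.map W)).map f with hη
  have hηz (z : 𝒵) : η z = (P.map W).map (fun w => f (z, w)) := by
    rw [hη, Kernel.map_apply _ hf, Kernel.prod_apply, Kernel.id_apply, Kernel.const_apply,
      Measure.dirac_prod, Measure.map_map hf (by fun_prop)]
    rfl
  have hXW : P.map (fun ω => (X ω, W ω)) = (P.map X).prod (P.map W) :=
    (indepFun_iff_map_prod_eq_prod_map_map hX hW).1 hind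
  have hY : AEMeasurable (fun ω => f (X ω, W ω)) P := hf.comp_aemeasurable (hX.prodMk hW)
  have key : condDistrib (fun ω => f (X ω, W ω)) X P =ᵐ[P.map X] η := by
    refine condDistrib_ae_eq_of_measure_eq_compProd X hY ?_
    refine Measure.ext_of_lintegral _ fun φ hφ => ?_
    rw [lintegral_map' hφ.aemeasurable (hX.prodMk hY), Measure.lintegral_compProd hφ]
    have h1 : ∫⁻ ω, φ (X ω, f (X ω, W ω)) ∂P =
        ∫⁻ q, φ (q.1, f q) ∂(P.map (fun ω => (X ω, W ω))) :=
      (lintegral_map' (f := fun q : 𝒵 × 𝒲 => φ (q.1, f q))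
        (by fun_prop) (hX.prodMk hW)).symm
    rw [h1, hXW, lintegral_prod _ (by fun_prop)]
    refine lintegral_congr fun z => ?_
    rw [hηz, lintegral_map (f := fun t => φ (z, t)) (by fun_prop) (by fun_prop)]
  filter_upwards [key] with z hz
  rw [hz, hηz]

/-- A centred Gaussian vector has independent coordinates in some orthonormal basis. -/
lemma exists_orthonormalBasis_iIndepFun {M : ℕ} (γ : Measure (Fin M → ℂ)) [IsGaussian γ]
    (h0 : ∫ x, x ∂γ = 0) :
    ∃ (n : ℕ) (e : OrthonormalBasis (Fin n) ℝ (PiLp 2 fun _ : Fin M => ℂ)) (l : Fin n → ℝ≥0),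
      iIndepFun (fun j x => ⟪e j, WithLp.toLp 2 x⟫) γ ∧
      ∀ j, HasLaw (fun x => ⟪e j, WithLp.toLp 2 x⟫) (gaussianReal 0 (l j)) γ := by
  let E := PiLp 2 fun _ : Fin M => ℂ
  let T : (Fin M → ℂ) ≃L[ℝ] E := (PiLp.continuousLinearEquiv 2 ℝ fun _ : Fin M => ℂ).symm
  -- The vector is moved to the Euclidean norm, over the real scalars, so that the covariance
  -- operator is symmetric and has an orthonormal eigenbasis.
  set γ' : Measure E := γ.map T with hγ'
  have hT : AEMeasurable T γ := T.continuous.measurable.aemeasurable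
  have hG : IsGaussian γ' := isGaussian_map_equiv T
  have hmem : MemLp id 2 γ' := IsGaussian.memLp_two_id
  have hsymm : (covarianceOperator γ').toLinearMap.IsSymmetric :=
    isPositive_covarianceOperator.isSymmetric
  let e := hsymm.eigenvectorBasis rfl
  have hgl : HasGaussianLaw (fun x (j : Fin (Module.finrank ℝ E)) => ⟪e j, T x⟫) γ :=
    (IsGaussian.hasGaussianLaw_id (μ := γ)).map_fun
      (ContinuousLinearMap.pi fun j => (innerSL ℝ (e j)).comp (T : (Fin M → ℂ) →L[ℝ] E))
  have hint : Integrable (fun x : Fin M → ℂ => x) γ :=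
    (IsGaussian.hasGaussianLaw_id (μ := γ)).integrable
  have hmean (j) : ∫ x, ⟪e j, T x⟫ ∂γ = 0 := by
    have := ((innerSL ℝ (e j)).comp (T : (Fin M → ℂ) →L[ℝ] E)).integral_comp_comm hint
    rw [h0, map_zero] at this
    exact this
  refine ⟨_, e, fun j => Var[fun x => ⟪e j, T x⟫; γ].toNNReal, ?_, fun j => ?_⟩
  · refine hgl.iIndepFun_of_covariance_eq_zero fun i j hij => ?_
    rw [covariance_eq_sub (hgl.eval i).memLp_two (hgl.eval j).memLp_two, hmean, zero_mul, sub_zero]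
    have h1 := covarianceOperator_inner hmem (e i) (e j)
    have h2 : covarianceOperator γ' (e i) = (hsymm.eigenvalues rfl i : ℝ) • e i :=
      hsymm.apply_eigenvectorBasis rfl i
    rw [h2, real_inner_smul_left, e.orthonormal.2 hij, mul_zero, hγ',
      integral_map hT (by fun_prop)] at h1
    exact h1.symm
  · refine ⟨(hgl.eval j).aemeasurable, ?_⟩
    have := (hgl.eval j).map_eq_gaussianReal
    rw [hmean] at this
    exact this

/-- Multiplication by `z` is a rotation scaled by `‖z‖`. Hence a real orthonormal family `e j`
yields orthogonal directions `e j zᵀ` of common squared length `∑ i, ‖z i‖ ^ 2`. -/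
lemma inner_mul_mul_right (a b z : ℂ) : ⟪a * z, b * z⟫ = ⟪a, b⟫ * ‖z‖ ^ 2 := by
  rw [← Complex.normSq_eq_norm_sq]
  simp only [Complex.inner, map_mul, Complex.mul_re, Complex.mul_im, Complex.conj_re,
    Complex.conj_im, Complex.normSq_apply]
  ring

/-- The mutual information of `Y = x zᵀ + N` and `x` for a centred Gaussian vector `x`, as a
function of the energy of `z` and of the noise variance. -/
theorem exists_klDiv_rankOne_channel {M : ℕ} (L : ℕ) (γ : Measure (Fin M → ℂ)) [IsGaussian γ]
    (h0 : ∫ x, x ∂γ = 0) :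
    ∃ (n : ℕ) (l : Fin n → ℝ≥0), ∀ (v : ℝ≥0), v ≠ 0 → ∀ z : Fin L → ℂ,
      InformationTheory.klDiv
        (((arrayGaussian M L v).prod γ).map (fun q => (q.1 + (fun m i => q.2 m * z i), q.2)))
        ((((arrayGaussian M L v).prod γ).map (fun q => q.1 + (fun m i => q.2 m * z i))).prod γ) =
      ENNReal.ofReal (∑ j, 1 / 2 * Real.log (1 + (∑ i, ‖z i‖ ^ 2) / (v / 2) * l j)) := by
  -- The basis and the variances depend on `γ` alone, so the same `l` serves every noise level and
  -- waveform; the comparison of the two schemes needs this.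
  obtain ⟨n, e, l, hind, hlaw⟩ := exists_orthonormalBasis_iIndepFun γ h0
  refine ⟨n, l, fun v hv z => ?_⟩
  -- The squared Cameron-Martin length of `e j zᵀ`: each real component of the noise has variance `v
  -- / 2`.
  set s : ℝ≥0 := ⟨(∑ i, ‖z i‖ ^ 2) / (v / 2), by positivity⟩ with hs
  refine (hasShiftDensity_arrayGaussian M L hv).klDiv_channel γ (c := fun j x => ⟪e j, WithLp.toLp 2 x⟫)
    (fun j => by fun_prop) hind l hlaw s (fun j m i => e j m * z i) (fun j k => ?_)
    (w := fun x m i => x m * z i) (by fun_prop) fun x => ?_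
  · have h1 : ∑ m, ⟪e j m, e k m⟫ = if j = k then (1 : ℝ) else 0 := by
      rw [← PiLp.inner_apply]
      exact orthonormal_iff_ite.1 e.orthonormal j k
    rw [arrayForm_apply]
    simp_rw [inner_mul_mul_right, ← Finset.mul_sum, ← Finset.sum_mul]
    rw [h1, ite_mul, one_mul, zero_mul, ite_div, zero_div]
    rfl
  · have h1 := congrArg WithLp.ofLp (e.sum_repr (WithLp.toLp 2 x))
    funext m i
    have h2 := congrFun h1 m
    simp only [e.repr_apply_apply] at h2
    rw [← h2]
    simp [Finset.sum_apply, Finset.sum_mul, mul_assoc]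

/-! ### Sensing rates: laws of target response and noise, waveform energies, comparison -/

namespace Model

variable {Ω : Type*} [MeasurableSpace Ω] {P : Measure Ω} {M L K : ℕ}

lemma aemeasurable_g (𝓜 : Model P M L K) : AEMeasurable 𝓜.g P := by
  have := fun k => (𝓜.β_law k).aemeasurable
  unfold g
  fun_prop

lemma hasGaussianLaw_g [IsProbabilityMeasure P] (𝓜 : Model P M L K) : HasGaussianLaw 𝓜.g P := by
  have hβ : iIndepFun 𝓜.β P := 𝓜.βNs_indep.precomp (g := Sum.inl) Sum.inl_injective
  have hG (k) : HasGaussianLaw (𝓜.β k) P := ⟨by rw [(𝓜.β_law k).map_eq]; infer_instance⟩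
  let T (k : Fin K) : ℂ →L[ℝ] (Fin M → ℂ) :=
    (ContinuousLinearMap.toSpanSingleton ℂ (fun m => 𝓜.a (𝓜.θ k) m)).restrictScalars ℝ
  have h := iIndepFun.hasGaussianLaw_fun_sum (X := fun k ω => T k (𝓜.β k ω))
    (fun k => (hG k).map_fun (T k)) (hβ.comp (fun k => T k) fun k => by fun_prop)
  convert! h using 1
  ext ω m
  simp [g, T]

lemma integral_g [IsProbabilityMeasure P] (𝓜 : Model P M L K) : ∫ ω, 𝓜.g ω ∂P = 0 := by
  have hG (k) : HasGaussianLaw (𝓜.β k) P := ⟨by rw [(𝓜.β_law k).map_eq]; infer_instance⟩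
  have e : 𝓜.g = fun ω => ∑ k, 𝓜.β k ω • fun m => 𝓜.a (𝓜.θ k) m := by
    ext ω m
    simp [g]
  rw [e, integral_finsetSum _ fun k _ => (hG k).integrable.smul_const _]
  refine Finset.sum_eq_zero fun k _ => ?_
  rw [integral_smul_const, (𝓜.β_law k).integral_eq, integral_id_complexGaussian, zero_smul]

/-- The scaled noise array. -/
def scaledNoise (𝓜 : Model P M L K) (b : ℝ) (ω : Ω) : Fin M → Fin L → ℂ :=
  fun m l => (Real.sqrt b : ℂ) * 𝓜.Ns m l ω

lemma hasLaw_scaledNoise [IsProbabilityMeasure P] (𝓜 : Model P M L K) (b : ℝ≥0) :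
    HasLaw (𝓜.scaledNoise b) (arrayGaussian M L (b * 𝓜.σs2)) P := by
  have hmeas := fun m l => (𝓜.Ns_law m l).aemeasurable
  have hN : iIndepFun (fun ml : Fin M × Fin L => 𝓜.Ns ml.1 ml.2) P :=
    𝓜.βNs_indep.precomp (g := Sum.inr) Sum.inr_injective
  have hN' : iIndepFun (fun (ml : Fin M × Fin L) ω => (Real.sqrt b : ℂ) * 𝓜.Ns ml.1 ml.2 ω) P :=
    hN.comp (fun _ z => (Real.sqrt b : ℂ) * z) fun _ => by fun_prop
  have hlaw (ml : Fin M × Fin L) : P.map (fun ω => (Real.sqrt b : ℂ) * 𝓜.Ns ml.1 ml.2 ω) =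
      complexGaussian (b * 𝓜.σs2) := by
    rw [← complexGaussian_map_const_mul, ← (𝓜.Ns_law ml.1 ml.2).map_eq,
      AEMeasurable.map_map_of_aemeasurable (by fun_prop) (hmeas _ _)]
    rfl
  have hmap := hN'.map_fun_eq_pi_map fun ml : Fin M × Fin L => (hmeas ml.1 ml.2).const_mul _
  simp_rw [hlaw] at hmap
  refine ⟨by unfold scaledNoise; fun_prop, ?_⟩
  -- Independence is indexed by pairs `(m, l)`; currying turns the product over pairs into the
  -- iterated product of `arrayGaussian`.
  have hc := Measure.infinitePi_map_curry
    (fun (_ : Fin M) (_ : Fin L) => complexGaussian (b * 𝓜.σs2))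
  simp only [Measure.infinitePi_eq_pi] at hc
  have hm : AEMeasurable
      (fun ω (ml : Fin M × Fin L) => (Real.sqrt b : ℂ) * 𝓜.Ns ml.1 ml.2 ω) P :=
    aemeasurable_pi_lambda _ fun ml => (hmeas ml.1 ml.2).const_mul _
  rw [arrayGaussian, ← hc, ← hmap, AEMeasurable.map_map_of_aemeasurable
    (MeasurableEquiv.measurable _).aemeasurable hm]
  rfl

lemma indepFun_β_Ns (𝓜 : Model P M L K) :
    IndepFun (fun ω k => 𝓜.β k ω) (fun ω m l => 𝓜.Ns m l ω) P := by
  classical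
  have hmeas : ∀ i, AEMeasurable
      (Sum.elim 𝓜.β (fun ml : Fin M × Fin L => 𝓜.Ns ml.1 ml.2) i) P := by
    rintro (k | ⟨m, l⟩)
    · exact (𝓜.β_law k).aemeasurable
    · exact (𝓜.Ns_law m l).aemeasurable
  have h := 𝓜.βNs_indep.indepFun_finset₀ (Finset.univ.image Sum.inl) (Finset.univ.image Sum.inr)
    (by simp [Finset.disjoint_left]) hmeas
  let φ : (↥(Finset.univ.image Sum.inl : Finset (Fin K ⊕ Fin M × Fin L)) → ℂ) → Fin K → ℂ :=
    fun x k => x ⟨Sum.inl k, by simp⟩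
  let ψ : (↥(Finset.univ.image Sum.inr : Finset (Fin K ⊕ Fin M × Fin L)) → ℂ) →
      Fin M → Fin L → ℂ := fun x m l => x ⟨Sum.inr (m, l), by simp⟩
  have hφ : Measurable φ := by fun_prop
  have hψ : Measurable ψ := by fun_prop
  exact h.comp hφ hψ

lemma hasLaw_scaledNoise_g [IsProbabilityMeasure P] (𝓜 : Model P M L K) (b : ℝ≥0) :
    HasLaw (fun ω => (𝓜.scaledNoise b ω, 𝓜.g ω))
      ((arrayGaussian M L (b * 𝓜.σs2)).prod (P.map 𝓜.g)) P := by
  have hg : HasLaw 𝓜.g (P.map 𝓜.g) P := ⟨𝓜.aemeasurable_g, rfl⟩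
  have : IsProbabilityMeasure (P.map 𝓜.g) := Measure.isProbabilityMeasure_map 𝓜.aemeasurable_g
  refine (indepFun_iff_hasLaw_prodMk_prod (𝓜.hasLaw_scaledNoise b) hg).1 ?_
  exact (𝓜.indepFun_β_Ns.comp (φ := fun x (m : Fin M) => ∑ k, x k * 𝓜.a (𝓜.θ k) m)
    (ψ := fun x (m : Fin M) (l : Fin L) => (Real.sqrt b : ℂ) * x m l)
    (by fun_prop) (by fun_prop)).symm

/-- The mutual information between the echo and the target response depends on the waveform only
through its energy. -/
theorem exists_condMutualInfo_eq [IsProbabilityMeasure P] (𝓜 : Model P M L K) :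
    ∃ (n : ℕ) (l : Fin n → ℝ≥0), ∀ (b : ℝ≥0), b ≠ 0 → ∀ (x : Ω → Fin L → ℂ), Measurable x →
      IndepFun x (fun ω => ((fun k => 𝓜.β k ω), (fun m l => 𝓜.Ns m l ω))) P →
      ∀ q : ℝ, (∀ᵐ ω ∂P, ∑ i, ‖x ω i‖ ^ 2 = q) →
      condMutualInfo P (𝓜.echo b x) 𝓜.g x =
        ENNReal.ofReal (∑ j, 1 / 2 * Real.log (1 + q / (b * 𝓜.σs2 / 2) * l j)) /
          ENNReal.ofReal (Real.log 2) := by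
  have : IsGaussian (P.map 𝓜.g) := 𝓜.hasGaussianLaw_g.isGaussian_map
  have h0 : ∫ x, x ∂(P.map 𝓜.g) = 0 := by
    rw [integral_map 𝓜.aemeasurable_g (by fun_prop), 𝓜.integral_g]
  obtain ⟨n, l, h⟩ := exists_klDiv_rankOne_channel L (P.map 𝓜.g) h0
  refine ⟨n, l, fun b hb x hx hind q hq => ?_⟩
  set W : Ω → (Fin M → Fin L → ℂ) × (Fin M → ℂ) := fun ω => (𝓜.scaledNoise b ω, 𝓜.g ω) with hW
  have hlaw := 𝓜.hasLaw_scaledNoise_g b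
  have hxW : IndepFun x W P := hind.comp (φ := id)
    (ψ := fun p : (Fin K → ℂ) × (Fin M → Fin L → ℂ) =>
      ((fun m l => (Real.sqrt b : ℂ) * p.2 m l), (fun m => ∑ k, p.1 k * 𝓜.a (𝓜.θ k) m))) measurable_id (by fun_prop)
  have hecho : 𝓜.echo b x = fun ω => (W ω).1 + fun m i => (W ω).2 m * x ω i := by
    ext ω m i
    simp only [echo, hW, scaledNoise, Pi.add_apply]
    ring
  -- Conditioning on the waveform, which is independent of noise and targets, amounts to freezing it
  -- at `z`, for the joint law and for both marginals.
  have c1 := condDistrib_ae_eq_map_of_indepFun hx.aemeasurable hlaw.aemeasurable hxW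
    (f := fun p => (p.2.1 + (fun m i => p.2.2 m * p.1 i), p.2.2)) (by fun_prop)
  have c2 := condDistrib_ae_eq_map_of_indepFun hx.aemeasurable hlaw.aemeasurable hxW
    (f := fun p => p.2.1 + (fun m i => p.2.2 m * p.1 i)) (by fun_prop)
  have c3 := condDistrib_ae_eq_map_of_indepFun hx.aemeasurable hlaw.aemeasurable hxW
    (f := fun p => p.2.2) (by fun_prop)
  have hq' : ∀ᵐ z ∂(P.map x), ∑ i, ‖z i‖ ^ 2 = q :=
    (ae_map_iff hx.aemeasurable (measurableSet_eq_fun (by fun_prop) (by fun_prop))).2 hq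
  have : IsProbabilityMeasure (P.map x) := Measure.isProbabilityMeasure_map hx.aemeasurable
  rw [condMutualInfo, hecho]
  congr 1
  -- The divergence given `z` depends only on the energy of `z`, which is almost surely `q`, so the
  -- integrand is almost everywhere constant.
  rw [lintegral_congr_ae (g := fun _ =>
    ENNReal.ofReal (∑ j, 1 / 2 * Real.log (1 + q / (b * 𝓜.σs2 / 2) * l j)))]
  · simp
  filter_upwards [c1, c2, c3, hq'] with z h1 h2 h3 h4
  simp only [hlaw.map_eq] at h1 h2 h3
  rw [← h4]
  have e3 : ((arrayGaussian M L (b * 𝓜.σs2)).prod (P.map 𝓜.g)).map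
      (fun w => w.2) = P.map 𝓜.g := by
    rw [← Measure.snd, Measure.snd_prod]
  rw [e3] at h3
  have hk := h (b * 𝓜.σs2) (mul_ne_zero hb 𝓜.σs2_pos.ne') z
  push_cast at hk
  rw [← hk, ← h1, ← h2]
  congr 2

/-- The two streams are orthogonal over the frame, so the cross terms vanish and the energies add up
to `p (αN + αF) L`. -/
lemma sum_norm_sq_isacWaveform (𝓜 : Model P M L K) :
    ∀ᵐ ω ∂P, ∑ i, ‖𝓜.isacWaveform ω i‖ ^ 2 = 𝓜.p * L := by
  filter_upwards [𝓜.S_gram] with ω h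
  have h00 := congrFun (congrFun h 0) 0
  have h01 := congrFun (congrFun h 0) 1
  have h10 := congrFun (congrFun h 1) 0
  have h11 := congrFun (congrFun h 1) 1
  simp only [Matrix.mul_apply, Matrix.conjTranspose_apply, Matrix.smul_apply, Matrix.one_apply_eq,
    smul_eq_mul, mul_one, ne_eq, one_ne_zero, zero_ne_one, not_false_eq_true,
    Matrix.one_apply_ne, mul_zero] at h00 h01 h10 h11
  have hN : (Real.sqrt 𝓜.αN : ℂ) * Real.sqrt 𝓜.αN = 𝓜.αN := by
    rw [← Complex.ofReal_mul, Real.mul_self_sqrt 𝓜.αN_nonneg]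
  have hF : (Real.sqrt 𝓜.αF : ℂ) * Real.sqrt 𝓜.αF = 𝓜.αF := by
    rw [← Complex.ofReal_mul, Real.mul_self_sqrt 𝓜.αF_nonneg]
  have hp : (Real.sqrt 𝓜.p : ℂ) * Real.sqrt 𝓜.p = 𝓜.p := by
    rw [← Complex.ofReal_mul, Real.mul_self_sqrt 𝓜.p_pos.le]
  have hα : (𝓜.αN : ℂ) + 𝓜.αF = 1 := by exact_mod_cast congrArg Complex.ofReal 𝓜.α_add
  apply Complex.ofReal_injective
  push_cast
  calc ∑ i, (‖𝓜.isacWaveform ω i‖ : ℂ) ^ 2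
      = ∑ i, 𝓜.isacWaveform ω i * star (𝓜.isacWaveform ω i) := by
        refine Finset.sum_congr rfl fun i _ => ?_
        rw [← Complex.mul_conj']
        rfl
    _ = (Real.sqrt 𝓜.p * Real.sqrt 𝓜.p) *
        ((Real.sqrt 𝓜.αN * Real.sqrt 𝓜.αN) * ∑ i, 𝓜.S ω 0 i * star (𝓜.S ω 0 i) +
        (Real.sqrt 𝓜.αN * Real.sqrt 𝓜.αF) * ∑ i, 𝓜.S ω 0 i * star (𝓜.S ω 1 i) +
        (Real.sqrt 𝓜.αN * Real.sqrt 𝓜.αF) * ∑ i, 𝓜.S ω 1 i * star (𝓜.S ω 0 i) +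
        (Real.sqrt 𝓜.αF * Real.sqrt 𝓜.αF) * ∑ i, 𝓜.S ω 1 i * star (𝓜.S ω 1 i)) := by
        simp only [Finset.mul_sum, ← Finset.sum_add_distrib]
        refine Finset.sum_congr rfl fun i _ => ?_
        simp only [isacWaveform, Complex.star_def, map_mul, map_add, Complex.conj_ofReal]
        ring
    _ = 𝓜.p * L := by
        rw [h00, h01, h10, h11, hN, hF, hp]
        linear_combination 𝓜.p * L * hα

lemma sum_norm_sq_fdsacWaveform (𝓜 : Model P M L K) {μ : ℝ} (hμ : μ ≤ 1) :
    ∀ᵐ ω ∂P, ∑ i, ‖𝓜.fdsacWaveform μ ω i‖ ^ 2 = (1 - μ) * 𝓜.p * L := by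
  filter_upwards [𝓜.s_power] with ω h
  have hp : 0 ≤ (1 - μ) * 𝓜.p := mul_nonneg (by linarith) 𝓜.p_pos.le
  simp only [fdsacWaveform, norm_mul, mul_pow, ← Finset.mul_sum, h, Complex.norm_real,
    Real.norm_eq_abs, sq_abs, Real.sq_sqrt hp]

lemma measurable_isacWaveform (𝓜 : Model P M L K) : Measurable 𝓜.isacWaveform := by
  have := 𝓜.S_meas
  unfold isacWaveform
  fun_prop

lemma measurable_fdsacWaveform (𝓜 : Model P M L K) (μ : ℝ) : Measurable (𝓜.fdsacWaveform μ) := by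
  have := 𝓜.s_meas
  unfold fdsacWaveform
  fun_prop

lemma indepFun_isacWaveform (𝓜 : Model P M L K) :
    IndepFun 𝓜.isacWaveform (fun ω => ((fun k => 𝓜.β k ω), (fun m l => 𝓜.Ns m l ω))) P := by
  let φ (S : Fin 2 → Fin L → ℂ) (l : Fin L) : ℂ := (Real.sqrt 𝓜.p : ℂ) *
    ((Real.sqrt 𝓜.αN : ℂ) * S 0 l + (Real.sqrt 𝓜.αF : ℂ) * S 1 l)
  have hφ : Measurable φ := by fun_prop
  exact 𝓜.S_indep.comp hφ measurable_id

lemma indepFun_fdsacWaveform (𝓜 : Model P M L K) (μ : ℝ) :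
    IndepFun (𝓜.fdsacWaveform μ)
      (fun ω => ((fun k => 𝓜.β k ω), (fun m l => 𝓜.Ns m l ω))) P := by
  let φ (s : Fin L → ℂ) (l : Fin L) : ℂ := (Real.sqrt ((1 - μ) * 𝓜.p) : ℂ) * s l
  have hφ : Measurable φ := by fun_prop
  exact 𝓜.s_indep.comp hφ measurable_id

theorem sensingRate_fdsac_le [IsProbabilityMeasure P] (𝓜 : Model P M L K) {κ μ : ℝ}
    (hκ : κ ∈ Icc (0 : ℝ) 1) (hμ : μ ∈ Icc (0 : ℝ) 1) :
    𝓜.sensingRate (1 - κ) (𝓜.fdsacWaveform μ) ≤ 𝓜.sensingRate 1 𝓜.isacWaveform := by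
  obtain ⟨n, l, h⟩ := 𝓜.exists_condMutualInfo_eq
  obtain ⟨hκ0, hκ1⟩ := hκ
  obtain ⟨hμ0, hμ1⟩ := hμ
  rcases hκ1.eq_or_lt with rfl | hκ
  -- With no bandwidth left the prefactor is zero; the noiseless information, possibly infinite, is
  -- never evaluated.
  · rw [sensingRate, sub_self, zero_div, ENNReal.ofReal_zero, zero_mul]
    exact zero_le
  obtain ⟨b, hb⟩ : ∃ b : ℝ≥0, (b : ℝ) = 1 - κ := ⟨⟨1 - κ, by linarith⟩, rfl⟩
  have hb0 : 0 < (b : ℝ) := by linarith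
  have hb1 : (b : ℝ) ≤ 1 := by linarith
  have hp := 𝓜.p_pos
  have hσ : (0 : ℝ) < 𝓜.σs2 := 𝓜.σs2_pos
  have hi := h 1 one_ne_zero _ 𝓜.measurable_isacWaveform 𝓜.indepFun_isacWaveform _
    𝓜.sum_norm_sq_isacWaveform
  have hf := h b (by exact_mod_cast hb0.ne') _ (𝓜.measurable_fdsacWaveform μ)
    (𝓜.indepFun_fdsacWaveform μ) _ (𝓜.sum_norm_sq_fdsacWaveform hμ1)
  rw [NNReal.coe_one] at hi
  rw [← hb, sensingRate, sensingRate, hi, hf, ← mul_div_assoc, ← mul_div_assoc,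
    ← ENNReal.ofReal_mul (by positivity), ← ENNReal.ofReal_mul (by positivity)]
  refine ENNReal.div_le_div_right (ENNReal.ofReal_le_ofReal ?_) _
  rw [div_mul_eq_mul_div, div_mul_eq_mul_div, Finset.mul_sum, Finset.mul_sum]
  refine div_le_div_of_nonneg_right (Finset.sum_le_sum fun j _ => ?_) (Nat.cast_nonneg L)
  have hl : (0 : ℝ) ≤ l j := (l j).2
  have h1μ : 0 ≤ 1 - μ := by linarith
  -- `t` is the signal-to-noise ratio of direction `j` under FDSAC. Multiplying it by `b` cancels
  -- the bandwidth in the noise variance and leaves `1 - μ` times the ratio under ISAC.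
  set t : ℝ := (1 - μ) * 𝓜.p * L / (b * 𝓜.σs2 / 2) * l j with ht
  have ht0 : 0 ≤ t := by positivity
  have hr : 0 ≤ 𝓜.p * L / (1 * 𝓜.σs2 / 2) * l j := by positivity
  have hbt : b * t ≤ 𝓜.p * L / (1 * 𝓜.σs2 / 2) * l j := by
    calc b * t = (1 - μ) * (𝓜.p * L / (1 * 𝓜.σs2 / 2) * l j) := by
          rw [ht]; field_simp
      _ ≤ 1 * (𝓜.p * L / (1 * 𝓜.σs2 / 2) * l j) :=
          mul_le_mul_of_nonneg_right (by linarith) hr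
      _ = _ := one_mul _
  have := (mul_log_one_add_le hb0.le hb1 ht0).trans
    (Real.log_le_log (by positivity) (add_le_add le_rfl hbt))
  linarith

end Model

end NomaIsac

end

theorem theorem4 {Ω : Type*} [MeasurableSpace Ω] (P : MeasureTheory.Measure Ω)
    [MeasureTheory.IsProbabilityMeasure P] (M L K : ℕ) (hL : 0 < L)
    (𝓜 : NomaIsac.Model P M L K) :
    𝓜.fdsacRegion ⊆ 𝓜.isacRegion := by
  rintro q ⟨κ, hκ, μ, hμ, h1, h2⟩
  exact ⟨h1.trans (𝓜.sensingRate_fdsac_le hκ hμ), h2.trans (𝓜.commRate_le hκ hμ)⟩
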